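/- Let $X$ be a finite set. A (synchronous) automaton over $X$ with finite state set $Q$ is a quadruple $A=\langle X,Q,\pi,\lambda\rangle$ with a transition function $\pi:X\times Q\to Q$ and an output function $\lambda:X\times Q\to X$. For $q\in Q$ it defines a map $\mathfrak T(A,q):X^*\to X^*$ on finite words by $\mathfrak T(A,q)(\emptyset)=\emptyset$ and $\mathfrak T(A,q)(xw)=\lambda(x,q)\,\mathfrak T(A,\pi(x,q))(w)$. The automaton $A$ is invertible if $\lambda(\cdot,q)$ is a permutation of $X$ for every $q\in Q$; its inverse $A^{-1}$ then has (up to renaming) the same states, output function $\overline\lambda(\cdot,q)=\lambda(\cdot,q)^{-1}$ and transition function $\overline\pi(x,q)=\pi(\overline\lambda(x,q),q)$. The dual automaton $A^*$ is obtained by exchanging $X$ with $Q$ and $\lambda$ with $\pi$. The automaton $A$ is bi-reversible if all of $A$, $A^*$, $A^{-1}$, $(A^{-1})^*$, $(A^*)^{-1}$, $((A^*)^{-1})^*$, $((A^{-1})^*)^{-1}$, $(((A^{-1})^*)^{-1})^*=(((A^*)^{-1})^*)^{-1}$ are well defined, that is, every automaton to which the inverse is applied in this list is invertible. A bi-reversible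 automatic transformation over $X$ is a map of the form $\mathfrak T(A,q)$ with $A$ a bi-reversible automaton over $X$ with finite state set $Q$ and $q\in Q$. Let $F_X$ be the free group on $X$ and let $T=\mathrm{Cay}(F_X,X)$ be its right Cayley graph: the vertices are the elements of $F_X$, and the edges join $g$ to $gx$ for $g\in F_X$, $x\in X$, and are oriented from $g$ to $gx$. Left multiplication embeds $F_X$ in the group $\mathrm{Aut}(T)$ of graph automorphisms. Let $$C=\{g\in \mathrm{Aut}(T) : gF_Xg^{-1}\cap F_X \text{ has finite index in both } F_X \text{ and } gF_Xg^{-1}\},$$ let $\mathrm{Aut}^{\mathrm{Dir}}(T)$ be the group of automorphisms of $T$ that preserve the orientation of the edges, and for a vertex $O$ of $T$ let $C_O^{\mathrm{Dir}}=\{g\in C\cap \mathrm{Aut}^{\mathrm{Dir}}(T) : g(O)=O\}$. Theorem (Macedońska, Nekrashevych and Sushchansky). The bi-reversible automatic transformations over $X$ are bijections of $X^*$ and form a group $\mathrm{Bat}(X)$ under composition. For every vertex $O$ of $T$, the group $\mathrm{Bat}(X)$ is isomorphic to $C_O^{\mathrm{Dir}}$. -/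

import Mathlib

universe u v

/-- A synchronous automaton over the alphabet `X` with set of states `Q`: a transition function
`π : X × Q → Q` and an output function `λ : X × Q → X`. (Finiteness of `X` and `Q` is imposed
where automata are used.) -/
structure SyncAutomaton (X : Type u) (Q : Type v) where
  /-- the transition function `π` -/
  trans : X → Q → Q
  /-- the output function `λ` -/
  out : X → Q → X

namespace SyncAutomaton

variable {X : Type u} {Q : Type v}

/-- The transformation of the set `X*` of finite words defined by the initial automaton `(A, q)`. -/
def transform (A : SyncAutomaton X Q) : Q → List X → List X
  | _, [] => []
  | q, x :: w => A.out x q :: A.transform (A.trans x q) w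

/-- The automaton is invertible if `λ(·, q)` is a permutation of the alphabet for every state. -/
def IsInvertible (A : SyncAutomaton X Q) : Prop :=
  ∀ q : Q, Function.Bijective fun x : X => A.out x q

/-- The inverse automaton of an invertible automaton, on the same set of states:
its output function is `λ(·, q)⁻¹`, and its transition function is `(x, q) ↦ π(λ(·, q)⁻¹ x, q)`. -/
noncomputable def inverse (A : SyncAutomaton X Q) (h : A.IsInvertible) : SyncAutomaton X Q where
  out x q := (Equiv.ofBijective _ (h q)).symm x
  trans x q := A.trans ((Equiv.ofBijective _ (h q)).symm x) q

/-- The dual automaton: states and letters, and output and transition functions, are exchanged. -/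
def dual (A : SyncAutomaton X Q) : SyncAutomaton Q X where
  trans q x := A.out x q
  out q x := A.trans x q

/-- Bi-reversibility: all the eight automata `A`, `A*`, `A⁻¹`, `(A⁻¹)*`, `(A*)⁻¹`, `((A*)⁻¹)*`,
`((A⁻¹)*)⁻¹`, `(((A*)⁻¹)*)⁻¹` (the last being the dual of the one before) are well defined, i.e.
every automaton in the list to which the inverse is applied is invertible. -/
def IsBireversible (A : SyncAutomaton X Q) : Prop :=
  ∃ (h : A.IsInvertible) (h' : A.dual.IsInvertible),
    (A.inverse h).dual.IsInvertible ∧ (A.dual.inverse h').dual.IsInvertible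

end SyncAutomaton

/-- The bi-reversible automatic transformations over `X`: the maps `X* → X*` defined by finite
bi-reversible automata with an initial state. (Every finite set of states is in bijection with
a type in the lowest universe, so nothing is lost by taking `Q : Type`.) -/
def bireversibleTransformations (X : Type u) : Set (List X → List X) :=
  {f | ∃ (Q : Type) (_ : Finite Q) (A : SyncAutomaton X Q) (q : Q),
    A.IsBireversible ∧ A.transform q = f}

/-- The right Cayley graph `Cay(F_X, X)`: `g` and `h` are adjacent iff `h = g x` or `g = h x`
for some generator `x ∈ X`. It is a tree. -/
abbrev freeCayley (X : Type u) : SimpleGraph (FreeGroup X) :=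
  SimpleGraph.mulCayley (Set.range (FreeGroup.of : X → FreeGroup X))

/-- The automorphism group of `Cay(F_X, X)`, with composition as multiplication. -/
abbrev freeCayleyAut (X : Type u) : Type u :=
  freeCayley X ≃g freeCayley X

/-- The action of `F_X` on `Cay(F_X, X)` by left multiplication. -/
def freeCayleyLeftMul (X : Type u) : FreeGroup X →* freeCayleyAut X where
  toFun k :=
    { toEquiv := Equiv.mulLeft k
      map_rel_iff' := by
        intro a b
        simp [SimpleGraph.mulCayley_adj', mul_assoc] }
  map_one' := by
    ext g
    change 1 * g = g
    exact one_mul g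
  map_mul' k l := by
    ext g
    change k * l * g = k * (l * g)
    exact mul_assoc k l g

/-- `F_X` as a subgroup of `Aut(Cay(F_X, X))`. -/
def freeLattice (X : Type u) : Subgroup (freeCayleyAut X) :=
  (freeCayleyLeftMul X).range

/-- `g → h` is a positively oriented edge of `Cay(F_X, X)`, i.e. `h = g x` with `x ∈ X`. -/
def IsPosEdge {X : Type u} (g h : FreeGroup X) : Prop :=
  ∃ x : X, h = g * FreeGroup.of x

/-- The group of directed automorphisms, i.e. those preserving the orientation of edges
(but not necessarily their labels). -/
def directedAut (X : Type u) : Subgroup (freeCayleyAut X) where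
  carrier := {φ | ∀ g h : FreeGroup X, IsPosEdge (φ g) (φ h) ↔ IsPosEdge g h}
  one_mem' := fun _ _ => Iff.rfl
  mul_mem' := fun {φ ψ} hφ hψ g h => (hφ (ψ g) (ψ h)).trans (hψ g h)
  inv_mem' := by
    intro φ hφ g h
    have key := hφ (φ⁻¹ g) (φ⁻¹ h)
    have e : ∀ a, φ (φ⁻¹ a) = a := fun a => φ.apply_symm_apply a
    rw [e, e] at key
    exact key.symm

/-- `C_O^Dir`: the directed automorphisms of `Cay(F_X, X)` that fix the vertex `O` and lie in
the commensurator of `F_X` in `Aut(Cay(F_X, X))`. -/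
def directedCommensuratorStabilizer (X : Type u) (O : FreeGroup X) :
    Subgroup (freeCayleyAut X) :=
  Subgroup.Commensurable.commensurator (freeLattice X) ⊓
    MulAction.stabilizer (freeCayleyAut X) O ⊓ directedAut X

/-! For an automorphism `φ` of the tree, consider the sections `h ↦ φ(g)⁻¹φ(gh)`. Two of them agree
exactly when `φ` conjugates the translation by `gh⁻¹` into `F_X` (`freeSection_eq_iff`), so `φ` is
in the commensurator iff it has finitely many sections. If `φ` is also directed and fixes `1`, its
sections are the states of a finite bi-reversible automaton giving its action on positive words.
Conversely, invertibility of `A*` lets `A` read inverse letters, so a state acts on `F_X`; the state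
of `A⁻¹`, extended likewise, inverts it (`freeOut_freeOut`). The sections of this action come from
states, hence are finite in number. The action on positive words is faithful by a finiteness
argument (`eq_one_of_apply_posWord`), and translations conjugate the stabilizers of different
vertices. -/

open Subgroup.Commensurable
open scoped Pointwise

/-! ### Criteria for bi-reversibility and renaming of states. -/

namespace SyncAutomaton

variable {X : Type*} {Q Q' : Type*}

/-- For finite automata, bi-reversibility amounts to three injectivity conditions. -/
theorem isBireversible_of_injective [Finite X] [Finite Q] (A : SyncAutomaton X Q)
    (h₁ : ∀ q, Function.Injective fun x => A.out x q)
    (h₂ : ∀ x, Function.Injective fun q => A.trans x q)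
    (h₃ : ∀ x q x' q', A.out x q = A.out x' q' → A.trans x q = A.trans x' q' → q = q') :
    A.IsBireversible := by
  have H₁ : A.IsInvertible := fun q => Finite.injective_iff_bijective.1 (h₁ q)
  have H₂ : A.dual.IsInvertible := fun x => Finite.injective_iff_bijective.1 (h₂ x)
  refine ⟨H₁, H₂, fun y => Finite.injective_iff_bijective.1 fun q q' h => ?_,
    fun r => Finite.injective_iff_bijective.1 fun x x' h => ?_⟩
  · refine h₃ _ _ _ _ ?_ h
    exact ((Equiv.ofBijective _ (H₁ q)).apply_symm_apply y).trans
      ((Equiv.ofBijective _ (H₁ q')).apply_symm_apply y).symm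
  · have h' : A.out x ((Equiv.ofBijective _ (H₂ x)).symm r) =
        A.out x' ((Equiv.ofBijective _ (H₂ x')).symm r) := h
    have e := h₃ _ _ _ _ h' (((Equiv.ofBijective _ (H₂ x)).apply_symm_apply r).trans
      ((Equiv.ofBijective _ (H₂ x')).apply_symm_apply r).symm)
    -- With the source states identified, injectivity of the output in that state identifies the
    -- letters.
    rw [e] at h'
    exact h₁ _ h'

/-- Renaming the states of an automaton. -/
def mapStates (A : SyncAutomaton X Q) (e : Q ≃ Q') : SyncAutomaton X Q' where
  trans x q := e (A.trans x (e.symm q))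
  out x q := A.out x (e.symm q)

theorem IsBireversible.mapStates [Finite X] [Finite Q] {A : SyncAutomaton X Q}
    (hA : A.IsBireversible) (e : Q ≃ Q') : (A.mapStates e).IsBireversible := by
  have : Finite Q' := Finite.of_equiv Q e
  obtain ⟨h, h', h₃, -⟩ := hA
  have inv : ∀ x q, (A.inverse h).trans (A.out x q) q = A.trans x q := fun x q =>
    congrArg (A.trans · q) ((Equiv.ofBijective _ (h q)).symm_apply_apply x)
  refine isBireversible_of_injective _ (fun q => (h _).injective)
    (fun x => e.injective.comp ((h' x).injective.comp e.symm.injective))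
    fun x q x' q' (e₁ : A.out x _ = A.out x' _) e₂ => e.symm.injective ?_
  have e₃ : A.trans x (e.symm q) = A.trans x' (e.symm q') := e.injective e₂
  refine (h₃ (A.out x (e.symm q))).injective ?_
  change (A.inverse h).trans _ _ = (A.inverse h).trans _ _
  rw [inv, e₃, e₁, inv]

theorem transform_mapStates (A : SyncAutomaton X Q) (e : Q ≃ Q') (q : Q) (w : List X) :
    (A.mapStates e).transform (e q) w = A.transform q w := by
  induction w generalizing q with
  | nil => rfl
  | cons x w ih => simp [transform, mapStates, ← ih]

/-! ### Reading elements of the free group with an automaton. -/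

section Walk

/-- The permutation of `Q × F_X` defined by reading the letter `x`. -/
noncomputable def stepPerm (A : SyncAutomaton X Q) (h : A.dual.IsInvertible) (x : X) :
    Equiv.Perm (Q × FreeGroup X) where
  toFun p := (A.trans x p.1, p.2 * FreeGroup.of (A.out x p.1))
  invFun p := ((Equiv.ofBijective _ (h x)).symm p.1,
    p.2 * (FreeGroup.of (A.out x ((Equiv.ofBijective _ (h x)).symm p.1)))⁻¹)
  left_inv p := by
    have : (Equiv.ofBijective _ (h x)).symm (A.trans x p.1) = p.1 :=
      (Equiv.ofBijective _ (h x)).symm_apply_apply p.1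
    simp [this]
  right_inv p := by
    have : A.trans x ((Equiv.ofBijective _ (h x)).symm p.1) = p.1 :=
      (Equiv.ofBijective _ (h x)).apply_symm_apply p.1
    simp [this]

/-- The right action of `F_X` on `Q × F_X` by reading a group element and multiplying by the
output. -/
noncomputable def walk (A : SyncAutomaton X Q) (h : A.dual.IsInvertible) :
    FreeGroup X →* (Equiv.Perm (Q × FreeGroup X))ᵐᵒᵖ :=
  -- The opposite group makes `v * w` read `v` before `w`.
  FreeGroup.lift fun x => MulOpposite.op (A.stepPerm h x)

/-- The state reached from `q` by reading an element of the free group. -/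
noncomputable def freeState (A : SyncAutomaton X Q) (h : A.dual.IsInvertible) (q : Q)
    (w : FreeGroup X) : Q :=
  ((A.walk h w).unop (q, 1)).1

/-- The output produced from `q` by reading an element of the free group. -/
noncomputable def freeOut (A : SyncAutomaton X Q) (h : A.dual.IsInvertible) (q : Q)
    (w : FreeGroup X) : FreeGroup X :=
  ((A.walk h w).unop (q, 1)).2

variable (A : SyncAutomaton X Q) (h : A.dual.IsInvertible)

/-- Each step multiplies the accumulated output on the right, so it commutes with left
multiplication. -/
theorem walk_apply_mul (w : FreeGroup X) (q : Q) (g k : FreeGroup X) :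
    (A.walk h w).unop (q, g * k) =
      (((A.walk h w).unop (q, k)).1, g * ((A.walk h w).unop (q, k)).2) := by
  induction w using FreeGroup.induction_on generalizing q k with
  | C1 => simp
  | of x => simp [walk, stepPerm, mul_assoc]
  | inv_of x _ => simp [walk, stepPerm, Equiv.Perm.inv_def, mul_assoc]
  | mul v w hv hw => simp [hv, hw]

theorem walk_apply (w : FreeGroup X) (q : Q) (g : FreeGroup X) :
    (A.walk h w).unop (q, g) = (A.freeState h q w, g * A.freeOut h q w) := by
  simpa [freeState, freeOut] using A.walk_apply_mul h w q g 1

@[simp]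
theorem freeState_one (q : Q) : A.freeState h q 1 = q := by simp [freeState]

@[simp]
theorem freeOut_one (q : Q) : A.freeOut h q 1 = 1 := by simp [freeOut]

theorem freeState_mul (q : Q) (v w : FreeGroup X) :
    A.freeState h q (v * w) = A.freeState h (A.freeState h q v) w := by
  rw [freeState, map_mul, MulOpposite.unop_mul, Equiv.Perm.mul_apply, walk_apply, walk_apply]

theorem freeOut_mul (q : Q) (v w : FreeGroup X) :
    A.freeOut h q (v * w) = A.freeOut h q v * A.freeOut h (A.freeState h q v) w := by
  rw [freeOut, map_mul, MulOpposite.unop_mul, Equiv.Perm.mul_apply, walk_apply, walk_apply,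
    one_mul]

theorem freeState_of (q : Q) (x : X) : A.freeState h q (FreeGroup.of x) = A.trans x q := by
  simp [freeState, walk, stepPerm]

theorem freeOut_of (q : Q) (x : X) :
    A.freeOut h q (FreeGroup.of x) = FreeGroup.of (A.out x q) := by
  simp [freeOut, walk, stepPerm]

theorem freeOut_inv (q : Q) (w : FreeGroup X) :
    A.freeOut h q w⁻¹ = (A.freeOut h (A.freeState h q w⁻¹) w)⁻¹ := by
  have := A.freeOut_mul h q w⁻¹ w
  rw [inv_mul_cancel, freeOut_one] at this
  exact eq_inv_of_mul_eq_one_left this.symm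

theorem freeState_inv_freeState (q : Q) (w : FreeGroup X) :
    A.freeState h (A.freeState h q w) w⁻¹ = q := by
  rw [← freeState_mul, mul_inv_cancel, freeState_one]

theorem freeState_freeState_inv (q : Q) (w : FreeGroup X) :
    A.freeState h (A.freeState h q w⁻¹) w = q := by
  rw [← freeState_mul, inv_mul_cancel, freeState_one]

/-- If `B` undoes `A` letter by letter, then it undoes `A` on the free group. -/
theorem freeOut_freeOut (B : SyncAutomaton X Q) (hB : B.dual.IsInvertible)
    (h₁ : ∀ x q, B.out (A.out x q) q = x) (h₂ : ∀ x q, B.trans (A.out x q) q = A.trans x q)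
    (q : Q) (w : FreeGroup X) :
    B.freeOut hB q (A.freeOut h q w) = w ∧
      B.freeState hB q (A.freeOut h q w) = A.freeState h q w := by
  have inv : ∀ w, (∀ q, B.freeOut hB q (A.freeOut h q w) = w ∧
      B.freeState hB q (A.freeOut h q w) = A.freeState h q w) →
      ∀ q, B.freeOut hB q (A.freeOut h q w⁻¹) = w⁻¹ ∧
        B.freeState hB q (A.freeOut h q w⁻¹) = A.freeState h q w⁻¹ := by
    intro w hw q
    -- Reading `w` leads from `r` to `q`; `B` follows the same path on the output, so reading the
    -- inverse output takes `B` from `q` back to `r`.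
    set r := A.freeState h q w⁻¹ with hr
    have hrq : A.freeState h r w = q := A.freeState_freeState_inv h q w
    have hs : B.freeState hB q (A.freeOut h r w)⁻¹ = r := by
      have := B.freeState_inv_freeState hB r (A.freeOut h r w)
      rwa [(hw r).2, hrq] at this
    rw [freeOut_inv, ← hr, freeOut_inv, hs, (hw r).1]
    exact ⟨rfl, rfl⟩
  induction w using FreeGroup.induction_on generalizing q with
  | C1 => simp
  | of x => simp [freeOut_of, freeState_of, h₁, h₂]
  | inv_of x ih => exact inv _ ih q
  | mul v w hv hw =>
    rw [freeOut_mul, freeOut_mul, freeState_mul, freeState_mul, (hv q).1, (hv q).2]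
    simp [hw]

end Walk

end SyncAutomaton

/-! ### Sections of tree automorphisms and the commensurator. -/

section FreeCayley

variable {X : Type*}

theorem freeCayley_adj (g h : FreeGroup X) :
    (freeCayley X).Adj g h ↔ IsPosEdge g h ∨ IsPosEdge h g := by
  rw [SimpleGraph.mulCayley_adj']
  constructor
  · rintro ⟨-, _, ⟨x, rfl⟩, e | e⟩
    exacts [Or.inl ⟨x, e.symm⟩, Or.inr ⟨x, e⟩]
  · rintro (⟨x, rfl⟩ | ⟨x, rfl⟩)
    · exact ⟨by simp, _, ⟨x, rfl⟩, Or.inl rfl⟩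
    · exact ⟨by simp, _, ⟨x, rfl⟩, Or.inr rfl⟩

/-- A permutation of `F_X` preserving positive edges is an automorphism of the Cayley graph. -/
def freeCayleyAutOfPerm (e : Equiv.Perm (FreeGroup X))
    (he : ∀ g h, IsPosEdge (e g) (e h) ↔ IsPosEdge g h) : freeCayleyAut X where
  toEquiv := e
  map_rel_iff' := by
    intro g h
    simp [freeCayley_adj, he]

@[simp]
theorem freeCayleyLeftMul_apply (k g : FreeGroup X) : freeCayleyLeftMul X k g = k * g := rfl

@[simp]
theorem freeCayleyLeftMul_inv_apply (k g : FreeGroup X) :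
    (freeCayleyLeftMul X k)⁻¹ g = k⁻¹ * g := by
  rw [← map_inv]
  rfl

theorem freeCayleyLeftMul_mem_directedAut (k : FreeGroup X) :
    freeCayleyLeftMul X k ∈ directedAut X := by
  intro g h
  simp [IsPosEdge, mul_assoc]

/-- The section of `φ` at the vertex `g`: the automorphism fixing the identity which describes the
action of `φ` seen from `g`. -/
def freeSection (φ : freeCayleyAut X) (g : FreeGroup X) : freeCayleyAut X :=
  (freeCayleyLeftMul X (φ g))⁻¹ * φ * freeCayleyLeftMul X g

theorem freeSection_apply (φ : freeCayleyAut X) (g h : FreeGroup X) :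
    freeSection φ g h = (φ g)⁻¹ * φ (g * h) := by
  simp [freeSection, RelIso.mul_apply]

theorem freeSection_apply_one (φ : freeCayleyAut X) (g : FreeGroup X) :
    freeSection φ g 1 = 1 := by
  simp [freeSection_apply]

theorem freeSection_one {φ : freeCayleyAut X} (h : φ 1 = 1) : freeSection φ 1 = φ := by
  ext g
  simp [freeSection_apply, h]

theorem freeSection_freeSection (φ : freeCayleyAut X) (g h : FreeGroup X) :
    freeSection (freeSection φ g) h = freeSection φ (g * h) := by
  ext k
  simp [freeSection_apply, mul_assoc]

theorem inv_freeSection (φ : freeCayleyAut X) (g : FreeGroup X) :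
    (freeSection φ g)⁻¹ = freeSection φ⁻¹ (φ g) := by
  have : φ⁻¹ (φ g) = g := φ.symm_apply_apply g
  simp [freeSection, this, mul_assoc]

theorem freeSection_mem_directedAut {φ : freeCayleyAut X} (h : φ ∈ directedAut X)
    (g : FreeGroup X) : freeSection φ g ∈ directedAut X :=
  mul_mem (mul_mem (inv_mem (freeCayleyLeftMul_mem_directedAut _)) h)
    (freeCayleyLeftMul_mem_directedAut _)

/-- When the sections agree, the conjugate is the translation by `φ g * (φ h)⁻¹`. -/
theorem freeSection_eq_iff (φ : freeCayleyAut X) (g h : FreeGroup X) :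
    freeSection φ g = freeSection φ h ↔
      φ * freeCayleyLeftMul X (g * h⁻¹) * φ⁻¹ ∈ freeLattice X := by
  constructor
  · intro e
    refine ⟨φ g * (φ h)⁻¹, ?_⟩
    simp only [freeSection, mul_assoc, inv_mul_eq_iff_eq_mul] at e
    rw [map_mul, map_mul, map_inv, map_inv, mul_inv_eq_iff_eq_mul, ← mul_assoc, e]
    group
  · rintro ⟨m, hm⟩
    have hm' : ∀ k, m * φ (h * k) = φ (g * k) := by
      intro k
      have := congrArg (fun ψ : freeCayleyAut X => ψ (φ (h * k))) hm
      have e : φ⁻¹ (φ (h * k)) = h * k := φ.symm_apply_apply _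
      simpa [RelIso.mul_apply, e, mul_assoc] using this
    ext k
    have h1 := hm' 1
    rw [mul_one, mul_one] at h1
    simp [freeSection_apply, ← hm' k, ← h1]

theorem index_comap_smul_freeLattice_ne_zero (φ : freeCayleyAut X) :
    ((ConjAct.toConjAct φ⁻¹ • freeLattice X).comap (freeCayleyLeftMul X)).index ≠ 0 ↔
      (Set.range (freeSection φ)).Finite := by
  set H := (ConjAct.toConjAct φ⁻¹ • freeLattice X).comap (freeCayleyLeftMul X) with hH
  have mem : ∀ k, k ∈ H ↔ φ * freeCayleyLeftMul X k * φ⁻¹ ∈ freeLattice X := by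
    intro k
    rw [hH, Subgroup.mem_comap, Subgroup.mem_pointwise_smul_iff_inv_smul_mem,
      ← ConjAct.toConjAct_inv, inv_inv, ConjAct.toConjAct_smul]
  have key : ∀ g h : FreeGroup X,
      freeSection φ g⁻¹ = freeSection φ h⁻¹ ↔ (g : FreeGroup X ⧸ H) = h := by
    intro g h
    rw [freeSection_eq_iff, inv_inv, ← mem, QuotientGroup.eq]
  -- The fibres of `freeSection φ` are right cosets of `H`; the inversion turns them into left
  -- cosets.
  let f : FreeGroup X ⧸ H → freeCayleyAut X :=
    Quotient.lift (fun g => freeSection φ g⁻¹) fun g h e => (key g h).2 (Quotient.sound e)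
  have hf : Function.Injective f := by
    rintro ⟨g⟩ ⟨h⟩ e
    exact (key g h).1 e
  have hr : Set.range f = Set.range (freeSection φ) := by
    ext ψ
    constructor
    · rintro ⟨⟨g⟩, rfl⟩
      exact ⟨g⁻¹, rfl⟩
    · rintro ⟨g, rfl⟩
      exact ⟨(g⁻¹ : FreeGroup X), congrArg (freeSection φ) (inv_inv g)⟩
  rw [← hr, ← Subgroup.finiteIndex_iff, Subgroup.finiteIndex_iff_finite_quotient,
    ← Set.finite_coe_iff, (Equiv.ofInjective f hf).finite_iff]

theorem finite_range_freeSection_inv {φ : freeCayleyAut X}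
    (h : (Set.range (freeSection φ)).Finite) : (Set.range (freeSection φ⁻¹)).Finite := by
  refine (h.image (fun ψ => ψ⁻¹)).subset ?_
  rintro _ ⟨g, rfl⟩
  refine ⟨_, ⟨φ⁻¹ g, rfl⟩, ?_⟩
  have : φ (φ⁻¹ g) = g := φ.apply_symm_apply g
  simp only [inv_freeSection, this]

/-- An automorphism commensurates the free group iff it has finitely many sections. -/
theorem mem_commensurator_freeLattice_iff (φ : freeCayleyAut X) :
    φ ∈ commensurator (freeLattice X) ↔ (Set.range (freeSection φ)).Finite := by
  have e₁ : ∀ ψ : freeCayleyAut X, (ConjAct.toConjAct ψ⁻¹ • freeLattice X).relIndex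
      (freeLattice X) ≠ 0 ↔ (Set.range (freeSection ψ)).Finite := by
    intro ψ
    rw [← index_comap_smul_freeLattice_ne_zero, Subgroup.index_comap]
    rfl
  -- The two index conditions thus concern the sections of `φ⁻¹` and of `φ`, which are inverses of
  -- each other.
  have e₂ : (freeLattice X).relIndex (ConjAct.toConjAct φ • freeLattice X) =
      (ConjAct.toConjAct φ⁻¹ • freeLattice X).relIndex (freeLattice X) := by
    rw [← Subgroup.relIndex_pointwise_smul (ConjAct.toConjAct φ) _ (freeLattice X),
      ← mul_smul, ← map_mul, mul_inv_cancel, map_one, one_smul]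
  rw [commensurator_mem_iff, Subgroup.Commensurable, e₂, e₁]
  constructor
  · exact And.right
  · intro h
    refine ⟨?_, h⟩
    have := (e₁ φ⁻¹).2 (finite_range_freeSection_inv h)
    rwa [inv_inv] at this

theorem mem_directedCommensuratorStabilizer_one_iff (φ : freeCayleyAut X) :
    φ ∈ directedCommensuratorStabilizer X 1 ↔
      (Set.range (freeSection φ)).Finite ∧ φ 1 = 1 ∧ φ ∈ directedAut X := by
  rw [directedCommensuratorStabilizer, Subgroup.mem_inf, Subgroup.mem_inf,
    mem_commensurator_freeLattice_iff, MulAction.mem_stabilizer_iff, and_assoc]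
  rfl

theorem freeCayleyLeftMul_mem_commensurator (k : FreeGroup X) :
    freeCayleyLeftMul X k ∈ commensurator (freeLattice X) := by
  rw [mem_commensurator_freeLattice_iff]
  refine (Set.finite_singleton 1).subset ?_
  rintro _ ⟨g, rfl⟩
  ext h
  simp [freeSection_apply, mul_assoc]

theorem conj_mem_directedCommensuratorStabilizer {O : FreeGroup X} {φ : freeCayleyAut X}
    (k : FreeGroup X) (h : φ ∈ directedCommensuratorStabilizer X O) :
    freeCayleyLeftMul X k * φ * (freeCayleyLeftMul X k)⁻¹ ∈
      directedCommensuratorStabilizer X (k * O) := by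
  obtain ⟨h₁₂, h₃⟩ := Subgroup.mem_inf.1 h
  obtain ⟨h₁, h₂⟩ := Subgroup.mem_inf.1 h₁₂
  have c := freeCayleyLeftMul_mem_commensurator k
  have d := freeCayleyLeftMul_mem_directedAut k
  refine Subgroup.mem_inf.2 ⟨Subgroup.mem_inf.2 ⟨mul_mem (mul_mem c h₁) (inv_mem c), ?_⟩,
    mul_mem (mul_mem d h₃) (inv_mem d)⟩
  have h₂' : φ O = O := h₂
  change (freeCayleyLeftMul X k * φ * (freeCayleyLeftMul X k)⁻¹) (k * O) = k * O
  simp [RelIso.mul_apply, h₂']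

/-- The groups `C_O^Dir` for different vertices are conjugate by left translations. -/
def directedCommensuratorStabilizerEquiv (O : FreeGroup X) :
    directedCommensuratorStabilizer X 1 ≃* directedCommensuratorStabilizer X O where
  toFun φ := ⟨freeCayleyLeftMul X O * φ * (freeCayleyLeftMul X O)⁻¹, by
    simpa using conj_mem_directedCommensuratorStabilizer O φ.2⟩
  invFun φ := ⟨(freeCayleyLeftMul X O)⁻¹ * φ * freeCayleyLeftMul X O, by
    simpa using conj_mem_directedCommensuratorStabilizer O⁻¹ φ.2⟩
  left_inv φ := Subtype.ext (by simp [mul_assoc])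
  right_inv φ := Subtype.ext (by simp [mul_assoc])
  map_mul' φ ψ := Subtype.ext (by simp [mul_assoc])

end FreeCayley

/-! ### The action on positive words and the automaton of sections. -/

section PositiveWords

variable {X : Type*}

/-- The element of the free group represented by a word in the generators. -/
def posWord (w : List X) : FreeGroup X := (w.map FreeGroup.of).prod

@[simp]
theorem posWord_nil : posWord ([] : List X) = 1 := rfl

@[simp]
theorem posWord_cons (x : X) (w : List X) :
    posWord (x :: w) = FreeGroup.of x * posWord w := by
  simp [posWord]

theorem posWord_eq_mk (w : List X) : posWord w = FreeGroup.mk (w.map fun x => (x, true)) := by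
  induction w with
  | nil => rfl
  | cons x w ih =>
    rw [posWord_cons, ih]
    rfl

/-- A word without inverse letters is reduced. -/
theorem posWord_injective : Function.Injective (posWord : List X → FreeGroup X) := by
  classical
  intro v w h
  have red : ∀ u : List X, FreeGroup.reduce (u.map fun x => (x, true)) =
      u.map fun x => (x, true) := by
    intro u
    rw [← FreeGroup.isReduced_iff_reduce_eq, FreeGroup.IsReduced, List.isChain_map]
    exact List.Pairwise.isChain (List.pairwise_of_forall fun _ _ _ => rfl)
  rw [posWord_eq_mk, posWord_eq_mk] at h
  have := congrArg FreeGroup.toWord h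
  rw [FreeGroup.toWord_mk, FreeGroup.toWord_mk, red, red] at this
  exact List.map_injective_iff.2 (fun a b e => congrArg Prod.fst e) this

/-- A directed automorphism fixing the identity permutes the generators. -/
theorem exists_apply_of {φ : freeCayleyAut X} (h : φ ∈ directedAut X) (h1 : φ 1 = 1) (x : X) :
    ∃ y, φ (FreeGroup.of x) = FreeGroup.of y := by
  have := (h 1 (FreeGroup.of x)).2 ⟨x, (one_mul _).symm⟩
  simpa [h1, IsPosEdge] using this

open Classical in
/-- The letter `y` such that `φ` maps the generator `x` to the generator `y`. -/
noncomputable def letterImage (φ : freeCayleyAut X) (x : X) : X :=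
  -- The fallback `x` never occurs for a directed automorphism fixing `1`.
  if h : ∃ y, φ (FreeGroup.of x) = FreeGroup.of y then h.choose else x

theorem apply_of {φ : freeCayleyAut X} (h : φ ∈ directedAut X) (h1 : φ 1 = 1) (x : X) :
    φ (FreeGroup.of x) = FreeGroup.of (letterImage φ x) := by
  rw [letterImage, dif_pos (exists_apply_of h h1 x)]
  exact (exists_apply_of h h1 x).choose_spec

/-- This is the automaton recursion: emit a letter, then continue in the section at `x`. -/
theorem apply_of_mul {φ : freeCayleyAut X} (h : φ ∈ directedAut X) (h1 : φ 1 = 1) (x : X)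
    (g : FreeGroup X) : φ (FreeGroup.of x * g) =
      FreeGroup.of (letterImage φ x) * freeSection φ (FreeGroup.of x) g := by
  rw [freeSection_apply, ← apply_of h h1, mul_inv_cancel_left]

theorem exists_apply_posWord {φ : freeCayleyAut X} (h : φ ∈ directedAut X) (h1 : φ 1 = 1)
    (w : List X) : ∃ v, φ (posWord w) = posWord v := by
  induction w generalizing φ with
  | nil => exact ⟨[], h1⟩
  | cons x w ih =>
    obtain ⟨v, hv⟩ := ih (freeSection_mem_directedAut h (FreeGroup.of x))
      (freeSection_apply_one _ _)
    exact ⟨letterImage φ x :: v, by rw [posWord_cons, apply_of_mul h h1, hv, posWord_cons]⟩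

/-- The action of a directed automorphism fixing the identity on positive words. -/
noncomputable def wordAction (φ : freeCayleyAut X) (w : List X) : List X :=
  Function.invFun posWord (φ (posWord w))

theorem posWord_wordAction {φ : freeCayleyAut X} (h : φ ∈ directedAut X) (h1 : φ 1 = 1)
    (w : List X) : posWord (wordAction φ w) = φ (posWord w) := by
  obtain ⟨v, hv⟩ := exists_apply_posWord h h1 w
  exact Function.invFun_eq ⟨v, hv.symm⟩

/-- `C_1^Dir` acts on finite words. -/
noncomputable def wordActionEnd :
    directedCommensuratorStabilizer X 1 →* Function.End (List X) where
  toFun φ := wordAction φ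
  map_one' := by
    funext w
    exact Function.leftInverse_invFun posWord_injective w
  map_mul' φ ψ := by
    have hφ := ((mem_directedCommensuratorStabilizer_one_iff _).1 φ.2).2
    have hψ := ((mem_directedCommensuratorStabilizer_one_iff _).1 ψ.2).2
    have hφψ := ((mem_directedCommensuratorStabilizer_one_iff _).1 (φ * ψ).2).2
    funext w
    apply posWord_injective
    change posWord (wordAction ↑(φ * ψ) w) = posWord (wordAction ↑φ (wordAction ↑ψ w))
    rw [posWord_wordAction hφψ.2 hφψ.1, posWord_wordAction hφ.2 hφ.1,
      posWord_wordAction hψ.2 hψ.1]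
    rfl

/-- `C_1^Dir` acts on finite words by permutations. -/
noncomputable def wordActionPerm :
    directedCommensuratorStabilizer X 1 →* Equiv.Perm (List X) :=
  MonoidHom.toHomPerm wordActionEnd

theorem coe_wordActionPerm (φ : directedCommensuratorStabilizer X 1) :
    (wordActionPerm φ : List X → List X) = wordAction φ := rfl

/-- Passing to the section at `x⁻¹` recovers the original section of `φ`. -/
theorem freeSection_of_injOn (φ : freeCayleyAut X) (x : X) {ψ ψ' : freeCayleyAut X}
    (h : ψ ∈ Set.range (freeSection φ)) (h' : ψ' ∈ Set.range (freeSection φ))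
    (e : freeSection ψ (FreeGroup.of x) = freeSection ψ' (FreeGroup.of x)) : ψ = ψ' := by
  obtain ⟨g, rfl⟩ := h
  obtain ⟨g', rfl⟩ := h'
  have := congrArg (freeSection · (FreeGroup.of x)⁻¹) e
  simpa [freeSection_freeSection] using this

theorem freeSection_mem_range {φ ψ : freeCayleyAut X} (h : ψ ∈ Set.range (freeSection φ))
    (g : FreeGroup X) : freeSection ψ g ∈ Set.range (freeSection φ) := by
  obtain ⟨k, rfl⟩ := h
  exact ⟨k * g, (freeSection_freeSection φ k g).symm⟩

/-- An automorphism with finitely many sections that fixes all positive words is trivial. -/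
theorem eq_one_of_apply_posWord {φ : freeCayleyAut X} (hf : (Set.range (freeSection φ)).Finite)
    (h : ∀ w, φ (posWord w) = posWord w) : φ = 1 := by
  let S : Set (freeCayleyAut X) :=
    {ψ | ψ ∈ Set.range (freeSection φ) ∧ ∀ w, ψ (posWord w) = posWord w}
  have hS : S.Finite := hf.subset fun ψ hψ => hψ.1
  have pos : ∀ x, Set.MapsTo (freeSection · (FreeGroup.of x)) S S := by
    intro x ψ hψ
    refine ⟨freeSection_mem_range hψ.1 _, fun w => ?_⟩
    have h1 := hψ.2 [x]
    have h2 := hψ.2 (x :: w)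
    simp only [posWord_cons, posWord_nil, mul_one] at h1 h2
    rw [freeSection_apply, h1, h2, inv_mul_cancel_left]
  -- The section at `x` is an injective self-map of the finite set `S`, hence onto; its inverse is
  -- the section at `x⁻¹`.
  have neg : ∀ x, ∀ ψ ∈ S, freeSection ψ (FreeGroup.of x)⁻¹ ∈ S := by
    intro x ψ hψ
    obtain ⟨χ, hχ, rfl⟩ := ((hS.injOn_iff_bijOn_of_mapsTo (pos x)).1
      fun a ha b hb e => freeSection_of_injOn φ x ha.1 hb.1 e).surjOn hψ
    have h1 : χ 1 = 1 := hχ.2 []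
    change freeSection (freeSection χ (FreeGroup.of x)) (FreeGroup.of x)⁻¹ ∈ S
    rwa [freeSection_freeSection, mul_inv_cancel, freeSection_one h1]
  have all : ∀ g : FreeGroup X, ∀ ψ ∈ S, ψ g = g ∧ freeSection ψ g ∈ S := by
    intro g
    induction g using FreeGroup.induction_on with
    | C1 =>
      intro ψ hψ
      have h1 : ψ 1 = 1 := hψ.2 []
      exact ⟨h1, by rwa [freeSection_one h1]⟩
    | of x =>
      intro ψ hψ
      exact ⟨by simpa using hψ.2 [x], pos x hψ⟩
    | inv_of x _ =>
      intro ψ hψ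
      refine ⟨?_, neg x ψ hψ⟩
      have h1 : ψ 1 = 1 := hψ.2 []
      -- The section at `x⁻¹` fixes `x` and sends it to `ψ(x⁻¹)⁻¹ψ(1)`.
      have := (neg x ψ hψ).2 [x]
      rw [freeSection_apply] at this
      rw [← inv_inj]
      simpa [h1] using this
    | mul g k hg hk =>
      intro ψ hψ
      obtain ⟨h1, h2⟩ := hg ψ hψ
      obtain ⟨h3, h4⟩ := hk _ h2
      rw [freeSection_apply, h1, inv_mul_eq_iff_eq_mul] at h3
      exact ⟨h3, by rwa [freeSection_freeSection] at h4⟩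
  have hφ : φ ∈ S := ⟨⟨1, freeSection_one (h [])⟩, h⟩
  ext g
  exact (all g φ hφ).1

theorem wordActionPerm_injective :
    Function.Injective (wordActionPerm : directedCommensuratorStabilizer X 1 →* _) := by
  rw [injective_iff_map_eq_one]
  intro φ h
  obtain ⟨hf, h1, hd⟩ := (mem_directedCommensuratorStabilizer_one_iff _).1 φ.2
  refine Subtype.ext (eq_one_of_apply_posWord hf fun w => ?_)
  rw [← posWord_wordAction hd h1, ← coe_wordActionPerm, h]
  rfl

/-- The automaton whose states are the sections of `φ`. -/
noncomputable def sectionAutomaton (φ : freeCayleyAut X) :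
    SyncAutomaton X (Set.range (freeSection φ)) where
  trans x ψ := ⟨freeSection ψ (FreeGroup.of x), freeSection_mem_range ψ.2 _⟩
  out x ψ := letterImage ψ x

theorem directed_of_mem_range {φ ψ : freeCayleyAut X} (h : φ ∈ directedAut X)
    (hψ : ψ ∈ Set.range (freeSection φ)) : ψ ∈ directedAut X ∧ ψ 1 = 1 := by
  obtain ⟨g, rfl⟩ := hψ
  exact ⟨freeSection_mem_directedAut h g, freeSection_apply_one φ g⟩

theorem isBireversible_sectionAutomaton [Finite X] {φ : freeCayleyAut X} (h : φ ∈ directedAut X)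
    (hf : (Set.range (freeSection φ)).Finite) : (sectionAutomaton φ).IsBireversible := by
  have : Finite (Set.range (freeSection φ)) := hf
  refine SyncAutomaton.isBireversible_of_injective _ ?_ ?_ ?_
  · rintro ⟨ψ, hψ⟩ x x' (e : letterImage ψ x = letterImage ψ x')
    obtain ⟨hd, h1⟩ := directed_of_mem_range h hψ
    apply FreeGroup.of_injective
    apply ψ.injective
    rw [apply_of hd h1, apply_of hd h1, e]
  · intro x ψ ψ' e
    exact Subtype.ext (freeSection_of_injOn φ x ψ.2 ψ'.2 (congrArg Subtype.val e))
  · rintro x ⟨ψ, hψ⟩ x' ⟨ψ', hψ'⟩ (e₁ : letterImage ψ x = letterImage ψ' x') e₂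
    obtain ⟨hd, h1⟩ := directed_of_mem_range h hψ
    obtain ⟨hd', h1'⟩ := directed_of_mem_range h hψ'
    have e := congrArg (fun χ : Set.range (freeSection φ) =>
      freeSection (χ : freeCayleyAut X)⁻¹ (FreeGroup.of (letterImage ψ x))⁻¹) e₂
    have inv1 : ∀ χ : freeCayleyAut X, χ 1 = 1 → χ⁻¹ 1 = 1 := fun χ hχ =>
      χ.symm_apply_eq.2 hχ.symm
    -- The output letter and the target state determine `χ⁻¹`, and so the source state.
    have back : ∀ (χ : freeCayleyAut X) (y : X), χ ∈ directedAut X → χ 1 = 1 →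
        freeSection (freeSection χ (FreeGroup.of y))⁻¹ (FreeGroup.of (letterImage χ y))⁻¹ =
          χ⁻¹ := by
      intro χ y hχ hχ1
      rw [inv_freeSection, apply_of hχ hχ1, freeSection_freeSection, mul_inv_cancel,
        freeSection_one (inv1 χ hχ1)]
    refine Subtype.ext (inv_injective ?_)
    calc ψ⁻¹ = _ := (back ψ x hd h1).symm
      _ = _ := e
      _ = freeSection (freeSection ψ' (FreeGroup.of x'))⁻¹
          (FreeGroup.of (letterImage ψ' x'))⁻¹ := by rw [e₁]; rfl
      _ = ψ'⁻¹ := back ψ' x' hd' h1'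

theorem transform_sectionAutomaton {φ : freeCayleyAut X} (h : φ ∈ directedAut X)
    (ψ : Set.range (freeSection φ)) (w : List X) :
    (sectionAutomaton φ).transform ψ w = wordAction ψ w := by
  obtain ⟨hd, h1⟩ := directed_of_mem_range h ψ.2
  apply posWord_injective
  rw [posWord_wordAction hd h1]
  induction w generalizing ψ with
  | nil => exact h1.symm
  | cons x w ih =>
    obtain ⟨hd', h1'⟩ := directed_of_mem_range h ((sectionAutomaton φ).trans x ψ).2
    rw [SyncAutomaton.transform, posWord_cons, posWord_cons, ih _ hd' h1', apply_of_mul hd h1]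
    rfl

theorem wordAction_mem_bireversibleTransformations [Finite X] {φ : freeCayleyAut X}
    (h : φ ∈ directedAut X) (h1 : φ 1 = 1) (hf : (Set.range (freeSection φ)).Finite) :
    wordAction φ ∈ bireversibleTransformations X := by
  have : Finite (Set.range (freeSection φ)) := hf
  -- States must live in `Type`, so the sections are renamed by `Fin n`.
  obtain ⟨n, ⟨e⟩⟩ := Finite.exists_equiv_fin (Set.range (freeSection φ))
  refine ⟨Fin n, inferInstance, (sectionAutomaton φ).mapStates e,
    e ⟨φ, 1, freeSection_one h1⟩, ?_, ?_⟩
  · exact (isBireversible_sectionAutomaton h hf).mapStates e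
  · funext w
    rw [SyncAutomaton.transform_mapStates, transform_sectionAutomaton h]

end PositiveWords

/-! ### From bi-reversible automata to tree automorphisms, and the isomorphism. -/

namespace SyncAutomaton

variable {X Q : Type*} (A : SyncAutomaton X Q)

theorem freeOut_posWord (h : A.dual.IsInvertible) (q : Q) (w : List X) :
    A.freeOut h q (posWord w) = posWord (A.transform q w) := by
  induction w generalizing q with
  | nil => simp [transform]
  | cons x w ih => simp [transform, freeOut_mul, freeOut_of, freeState_of, ih]

theorem isPosEdge_freeOut (h : A.dual.IsInvertible) (q : Q) {g k : FreeGroup X}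
    (e : IsPosEdge g k) : IsPosEdge (A.freeOut h q g) (A.freeOut h q k) := by
  obtain ⟨x, rfl⟩ := e
  exact ⟨_, by rw [freeOut_mul, freeOut_of]⟩

/-- A state of a bi-reversible automaton acts on the Cayley graph of the free group. -/
theorem exists_freeCayleyAut (hA : A.IsBireversible) :
    ∃ (h : A.dual.IsInvertible), ∀ q, ∃ φ ∈ directedAut X, ∀ g, φ g = A.freeOut h q g := by
  obtain ⟨h, h', h₃, -⟩ := hA
  refine ⟨h', fun q => ?_⟩
  have a₁ : ∀ x q, (A.inverse h).out (A.out x q) q = x := fun x q =>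
    (Equiv.ofBijective _ (h q)).symm_apply_apply x
  have a₂ : ∀ x q, A.out ((A.inverse h).out x q) q = x := fun x q =>
    (Equiv.ofBijective _ (h q)).apply_symm_apply x
  have b₂ : ∀ x q, A.trans ((A.inverse h).out x q) q = (A.inverse h).trans x q := fun _ _ => rfl
  have b₁ : ∀ x q, (A.inverse h).trans (A.out x q) q = A.trans x q := fun x q => by
    rw [← b₂, a₁]
  have left := fun g => (A.freeOut_freeOut h' (A.inverse h) h₃ a₁ b₁ q g).1
  have right := fun g => ((A.inverse h).freeOut_freeOut h₃ A h' a₂ b₂ q g).1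
  let e : Equiv.Perm (FreeGroup X) :=
    ⟨A.freeOut h' q, (A.inverse h).freeOut h₃ q, left, right⟩
  have he : ∀ g k, IsPosEdge (e g) (e k) ↔ IsPosEdge g k := fun g k =>
    ⟨fun p => by simpa [e, left] using (A.inverse h).isPosEdge_freeOut h₃ q p,
      A.isPosEdge_freeOut h' q⟩
  exact ⟨freeCayleyAutOfPerm e he, he, fun _ => rfl⟩

end SyncAutomaton

theorem exists_wordAction_eq {X : Type*} {f : List X → List X}
    (hf : f ∈ bireversibleTransformations X) :
    ∃ φ ∈ directedCommensuratorStabilizer X 1, wordAction φ = f := by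
  obtain ⟨Q, _, A, q, hA, rfl⟩ := hf
  obtain ⟨h, H⟩ := A.exists_freeCayleyAut hA
  choose Φ hd hΦ using H
  have h1 : Φ q 1 = 1 := by rw [hΦ, SyncAutomaton.freeOut_one]
  refine ⟨Φ q, ?_, ?_⟩
  · rw [mem_directedCommensuratorStabilizer_one_iff]
    refine ⟨(Set.finite_range Φ).subset ?_, h1, hd q⟩
    rintro _ ⟨g, rfl⟩
    -- The section of `Φ q` at `g` is `Φ` of the state reached by reading `g`.
    refine ⟨A.freeState h q g, ?_⟩
    ext k
    rw [freeSection_apply, hΦ, hΦ, hΦ, SyncAutomaton.freeOut_mul, inv_mul_cancel_left]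
  · funext w
    apply posWord_injective
    rw [posWord_wordAction (hd q) h1, hΦ, SyncAutomaton.freeOut_posWord]

theorem mainTheorem4 (X : Type*) [Finite X] :
    ∃ Bat : Subgroup (Equiv.Perm (List X)),
      (fun σ : Equiv.Perm (List X) => (σ : List X → List X)) '' (Bat : Set (Equiv.Perm (List X))) =
        bireversibleTransformations X ∧
      ∀ O : FreeGroup X, Nonempty (Bat ≃* directedCommensuratorStabilizer X O) := by
  refine ⟨wordActionPerm.range, ?_, fun O =>
    ⟨(MonoidHom.ofInjective wordActionPerm_injective).symm.trans
      (directedCommensuratorStabilizerEquiv O)⟩⟩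
  ext f
  constructor
  · rintro ⟨_, ⟨φ, rfl⟩, rfl⟩
    obtain ⟨hf, h1, hd⟩ := (mem_directedCommensuratorStabilizer_one_iff _).1 φ.2
    exact wordAction_mem_bireversibleTransformations hd h1 hf
  · intro hf
    obtain ⟨φ, hφ, rfl⟩ := exists_wordAction_eq hf
    exact ⟨_, ⟨⟨φ, hφ⟩, rfl⟩, rfl⟩
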